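/- Let $\mu,\nu$ be probability measures on $\mathbb{R}$ with finite first moments such that $\mu\preceq\nu$ in the convex order (i.e. $\int g\,d\mu\le\int g\,d\nu$ for every convex $g:\mathbb{R}\to\mathbb{R}$), and suppose that $\mu$ has no atoms. Let $\mathcal{M}(\mu,\nu)$ be the set of probability measures $\mathbb{P}$ on $\mathbb{R}\times\mathbb{R}$ such that, for the coordinate maps $X(x,y)=x$ and $Y(x,y)=y$, one has $X\sim_{\mathbb{P}}\mu$, $Y\sim_{\mathbb{P}}\nu$ and $\mathbb{E}^{\mathbb{P}}[Y\mid X]=X$ almost surely. Let $c:\mathbb{R}\times\mathbb{R}\to\mathbb{R}$ satisfy the martingale Spence--Mirrlees condition: $c$ is (Borel) measurable, $x\mapsto c(x,y)$ is continuously differentiable for every $y$, and $y\mapsto c_x(x,y)$ is strictly convex on $\mathbb{R}$ for every $x$. Assume that there are $a\in L^1(\mu)$ and $b\in L^1(\nu)$ with $c(x,y)\le a(x)+b(y)$ for all $x,y\in\mathbb{R}$, so that $\mathbb{E}^{\mathbb{P}}[c(X,Y)]\in\mathbb{R}\cup\{-\infty\}$ is well defined for every $\mathbb{P}\in\mathcal{M}(\mu,\nu)$,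 and that the value $$\mathbf{P}(c):=\sup_{\mathbb{P}\in\mathcal{M}(\mu,\nu)}\mathbb{E}^{\mathbb{P}}[c(X,Y)]$$ is not $-\infty$. Then the martingale transport problem $\mathbf{P}(c)$ has at most one solution, i.e. there is at most one $\mathbb{P}\in\mathcal{M}(\mu,\nu)$ with $\mathbb{E}^{\mathbb{P}}[c(X,Y)]=\mathbf{P}(c)$. -/

import Mathlib

open MeasureTheory

namespace MOT

/-- The expectation `E^P[f] = E^P[f⁺] - E^P[f⁻]` with values in the extended reals. It is the usual
one as soon as `f⁺` or `f⁻` has finite expectation, which is the case wherever it is used below. -/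
noncomputable def extExpectation {Ω : Type*} [MeasurableSpace Ω] (P : Measure Ω) (f : Ω → ℝ) :
    EReal :=
  ((∫⁻ ω, ENNReal.ofReal (f ω) ∂P : ENNReal) : EReal)
    - ((∫⁻ ω, ENNReal.ofReal (-f ω) ∂P : ENNReal) : EReal)

/-- Convex order: `μ(g) ≤ ν(g)` for all convex functions `g : ℝ → ℝ`. For measures with finite
first moment both sides are well defined in `(-∞, ∞]`, as `g` is bounded below by an affine
function. -/
def ConvexOrder (μ ν : Measure ℝ) : Prop :=
  ∀ g : ℝ → ℝ, ConvexOn ℝ Set.univ g → extExpectation μ g ≤ extExpectation ν g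

/-- `P ∈ 𝓜(μ, ν)`: a probability measure on `ℝ × ℝ` with `X ∼ μ`, `Y ∼ ν` and `E^P[Y | X] = X`
almost surely, where `X` and `Y` are the two coordinates. -/
structure IsMartingaleCoupling (μ ν : Measure ℝ) (P : Measure (ℝ × ℝ)) : Prop where
  isProbabilityMeasure : IsProbabilityMeasure P
  map_fst : P.map Prod.fst = μ
  map_snd : P.map Prod.snd = ν
  condExp_eq : condExp (MeasurableSpace.comap (Prod.fst : ℝ × ℝ → ℝ) inferInstance) P
    (Prod.snd : ℝ × ℝ → ℝ) =ᵐ[P] Prod.fst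

/-- The value `sup_{P ∈ 𝓜(μ, ν)} E^P[c(X, Y)]` of the martingale transport problem. -/
noncomputable def transportValue (μ ν : Measure ℝ) (c : ℝ → ℝ → ℝ) : EReal :=
  ⨆ (P : Measure (ℝ × ℝ)) (_ : IsMartingaleCoupling μ ν P),
    extExpectation P (fun ω => c ω.1 ω.2)

/-- `P` is a solution of the martingale transport problem: it lies in `𝓜(μ, ν)` and attains the
value. -/
def IsSolution (μ ν : Measure ℝ) (c : ℝ → ℝ → ℝ) (P : Measure (ℝ × ℝ)) : Prop :=
  IsMartingaleCoupling μ ν P ∧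
    extExpectation P (fun ω => c ω.1 ω.2) = transportValue μ ν c

/-- The martingale Spence–Mirrlees condition: `c` is measurable, continuously differentiable in
`x`, and `c_x(x, ·)` is strictly convex on `ℝ` for every `x`. -/
structure MartingaleSpenceMirrlees (c : ℝ → ℝ → ℝ) : Prop where
  measurable : Measurable (fun ω : ℝ × ℝ => c ω.1 ω.2)
  contDiff : ∀ y : ℝ, ContDiff ℝ 1 (fun x => c x y)
  strictConvexOn : ∀ x : ℝ, StrictConvexOn ℝ Set.univ (fun y => deriv (fun ξ => c ξ y) x)

/-- `c ≤ a ⊕ b` for some `a ∈ L¹(μ)` and `b ∈ L¹(ν)`. -/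
def HasIntegrableUpperBound (μ ν : Measure ℝ) (c : ℝ → ℝ → ℝ) : Prop :=
  ∃ a b : ℝ → ℝ, Integrable a μ ∧ Integrable b ν ∧ ∀ x y : ℝ, c x y ≤ a x + b y

end MOT

open Set ProbabilityTheory
open scoped ENNReal NNReal

namespace MOT

/-! The heart of the matter is that an optimal coupling has conditional laws of `Y` given `X`
carried by at most two points (`ae_exists_pair`). Otherwise, on a set of `x` of positive
`μ`-measure, the conditional laws charge `(-∞, q)`, `(q, r)` and `(r, ∞)` for fixed rationals `q <
r`. As `μ` has no atoms, this set has mass on both sides of some `z`. Take `x < z < x'` in it,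
targets `u < q` and `v > r` of `x`, and a target `y ∈ (q, r)` of `x'`. Writing `y = l u + k v` and
exchanging `x` with `x'` preserves both marginals and the martingale property. By strict convexity
of `c_x` the reward rises (`MartingaleSpenceMirrlees.reward_lt`). Performed on a mixture of such
configurations, the exchange contradicts optimality (`eq_zero_of_reward_lt`).

If `P₁` and `P₂` are optimal, so is their midpoint. For almost every `x` its conditional law is
carried by some pair `{a, b}`, which then carries the conditional laws of `P₁` and `P₂` as well.
Both have mean `x`, and a law on a given pair is determined by its mean; hence `P₁ = P₂`. -/

/-! ### Extended expectations and integrability. -/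

lemma extExpectation_of_integrable {Ω : Type*} [MeasurableSpace Ω] {P : Measure Ω} {f : Ω → ℝ}
    (hf : Integrable f P) : extExpectation P f = ((∫ ω, f ω ∂P : ℝ) : EReal) := by
  have h₁ : ∫⁻ ω, ENNReal.ofReal (f ω) ∂P ≠ ∞ := hf.lintegral_lt_top.ne
  have h₂ : ∫⁻ ω, ENNReal.ofReal (-f ω) ∂P ≠ ∞ := hf.neg.lintegral_lt_top.ne
  rw [integral_eq_lintegral_pos_part_sub_lintegral_neg_part hf, extExpectation, EReal.coe_sub,
    EReal.coe_ennreal_toReal h₁, EReal.coe_ennreal_toReal h₂]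

lemma integrable_of_extExpectation_ne_bot {Ω : Type*} [MeasurableSpace Ω] {P : Measure Ω}
    {f g : Ω → ℝ} (hf : Measurable f) (hg : Integrable g P) (hfg : ∀ ω, f ω ≤ g ω)
    (h : extExpectation P f ≠ ⊥) : Integrable f P := by
  have h₁ : ∫⁻ ω, ENNReal.ofReal (f ω) ∂P ≠ ∞ :=
    ((lintegral_mono fun ω => ENNReal.ofReal_le_ofReal (hfg ω)).trans_lt hg.lintegral_lt_top).ne
  have h₂ : ∫⁻ ω, ENNReal.ofReal (-f ω) ∂P ≠ ∞ := by
    intro h₂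
    apply h
    -- In `EReal`, subtracting `⊤` always gives `⊥`, so an infinite negative part forces the value
    -- `⊥`.
    rw [extExpectation, h₂, EReal.coe_ennreal_top, EReal.sub_top]
  refine ⟨hf.aestronglyMeasurable, ?_⟩
  rw [hasFiniteIntegral_iff_norm]
  calc ∫⁻ ω, ENNReal.ofReal ‖f ω‖ ∂P
      ≤ ∫⁻ ω, ENNReal.ofReal (f ω) + ENNReal.ofReal (-f ω) ∂P := by
        refine lintegral_mono fun ω => ?_
        rcases le_total 0 (f ω) with h0 | h0
        · rw [Real.norm_of_nonneg h0]; exact le_self_add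
        · rw [Real.norm_of_nonpos h0]; exact le_add_self
    _ = _ := lintegral_add_left hf.ennreal_ofReal _
    _ < ∞ := ENNReal.add_lt_top.2 ⟨h₁.lt_top, h₂.lt_top⟩

/-! ### Martingale couplings tested on events of the first coordinate. -/

section Couplings

variable {μ ν : Measure ℝ} {P : Measure (ℝ × ℝ)}

lemma IsMartingaleCoupling.integrable_comp_fst (hP : IsMartingaleCoupling μ ν P) {f : ℝ → ℝ}
    (hf : Integrable f μ) : Integrable (fun ω : ℝ × ℝ => f ω.1) P :=
  Integrable.comp_measurable (f := Prod.fst) (by rwa [hP.map_fst]) measurable_fst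

lemma IsMartingaleCoupling.integrable_comp_snd (hP : IsMartingaleCoupling μ ν P) {f : ℝ → ℝ}
    (hf : Integrable f ν) : Integrable (fun ω : ℝ × ℝ => f ω.2) P :=
  Integrable.comp_measurable (f := Prod.snd) (by rwa [hP.map_snd]) measurable_snd

lemma IsMartingaleCoupling.setIntegral_sub (hμ : Integrable (fun x : ℝ => x) μ)
    (hν : Integrable (fun y : ℝ => y) ν) (hP : IsMartingaleCoupling μ ν P) {B : Set ℝ}
    (hB : MeasurableSet B) : ∫ ω in Prod.fst ⁻¹' B, (ω.2 - ω.1) ∂P = 0 := by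
  have := hP.isProbabilityMeasure
  rw [integral_sub (hP.integrable_comp_snd hν).integrableOn
    (hP.integrable_comp_fst hμ).integrableOn, sub_eq_zero]
  have hm : MeasurableSpace.comap (Prod.fst : ℝ × ℝ → ℝ) inferInstance ≤ Prod.instMeasurableSpace :=
    measurable_fst.comap_le
  rw [← setIntegral_condExp hm (hP.integrable_comp_snd hν) ⟨B, hB, rfl⟩]
  exact setIntegral_congr_ae (measurable_fst hB) (hP.condExp_eq.mono fun ω h _ => h)

/-- Unlike the conditional expectation, this criterion is linear in `P`, so it can be checked for
sums and differences of measures. -/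
lemma isMartingaleCoupling_of_setIntegral (hμ : Integrable (fun x : ℝ => x) μ)
    (hν : Integrable (fun y : ℝ => y) ν) [IsProbabilityMeasure P] (h₁ : P.map Prod.fst = μ)
    (h₂ : P.map Prod.snd = ν)
    (h : ∀ B : Set ℝ, MeasurableSet B → ∫ ω in Prod.fst ⁻¹' B, (ω.2 - ω.1) ∂P = 0) :
    IsMartingaleCoupling μ ν P := by
  refine ⟨inferInstance, h₁, h₂, ?_⟩
  have hm : MeasurableSpace.comap (Prod.fst : ℝ × ℝ → ℝ) inferInstance ≤ Prod.instMeasurableSpace :=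
    measurable_fst.comap_le
  have i₁ : Integrable (Prod.fst : ℝ × ℝ → ℝ) P :=
    Integrable.comp_measurable (f := Prod.fst) (by rwa [h₁]) measurable_fst
  have i₂ : Integrable (Prod.snd : ℝ × ℝ → ℝ) P :=
    Integrable.comp_measurable (f := Prod.snd) (by rwa [h₂]) measurable_snd
  refine (ae_eq_condExp_of_forall_setIntegral_eq hm i₂ (fun s _ _ => i₁.integrableOn) ?_
    (comap_measurable Prod.fst).aestronglyMeasurable).symm
  rintro _ ⟨B, hB, rfl⟩ -
  have := h B hB
  rw [integral_sub i₂.integrableOn i₁.integrableOn, sub_eq_zero] at this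
  exact this.symm

end Couplings

/-! ### Mixtures of three-point configurations. -/

section ThreePoint

variable {Ω : Type*} [MeasurableSpace Ω]

/-- The mixture over `ρ` of the masses `l`, `k` and `1` at `(x, u)`, `(x, v)` and `(x', y)`. -/
noncomputable def threePoint (ρ : Measure Ω) (l k : Ω → ℝ≥0) (x x' u v y : Ω → ℝ) :
    Measure (ℝ × ℝ) :=
  (ρ.withDensity fun ω => l ω).map (fun ω => (x ω, u ω))
    + (ρ.withDensity fun ω => k ω).map (fun ω => (x ω, v ω)) + ρ.map (fun ω => (x' ω, y ω))

variable {ρ : Measure Ω} {l k : Ω → ℝ≥0} {x x' u v y : Ω → ℝ}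

lemma integrable_threePoint_iff (hl : Measurable l) (hk : Measurable k) (hx : Measurable x)
    (hx' : Measurable x') (hu : Measurable u) (hv : Measurable v) (hy : Measurable y)
    {f : ℝ × ℝ → ℝ} (hf : AEStronglyMeasurable f (threePoint ρ l k x x' u v y)) :
    Integrable f (threePoint ρ l k x x' u v y) ↔
      Integrable (fun ω => l ω * f (x ω, u ω)) ρ ∧ Integrable (fun ω => k ω * f (x ω, v ω)) ρ ∧
        Integrable (fun ω => f (x' ω, y ω)) ρ := by
  unfold threePoint at hf ⊢
  obtain ⟨hf₁₂, hf₃⟩ := aestronglyMeasurable_add_measure_iff.1 hf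
  obtain ⟨hf₁, hf₂⟩ := aestronglyMeasurable_add_measure_iff.1 hf₁₂
  rw [integrable_add_measure, integrable_add_measure,
    integrable_map_measure hf₁ (hx.prodMk hu).aemeasurable,
    integrable_map_measure hf₂ (hx.prodMk hv).aemeasurable,
    integrable_map_measure hf₃ (hx'.prodMk hy).aemeasurable,
    integrable_withDensity_iff_integrable_smul hl, integrable_withDensity_iff_integrable_smul hk,
    and_assoc]
  rfl

lemma integral_threePoint (hl : Measurable l) (hk : Measurable k) (hx : Measurable x)
    (hx' : Measurable x') (hu : Measurable u) (hv : Measurable v) (hy : Measurable y)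
    {f : ℝ × ℝ → ℝ} (hf : Integrable f (threePoint ρ l k x x' u v y)) :
    ∫ p, f p ∂(threePoint ρ l k x x' u v y) =
      ∫ ω, (l ω * f (x ω, u ω) + k ω * f (x ω, v ω) + f (x' ω, y ω)) ∂ρ := by
  obtain ⟨i₁, i₂, i₃⟩ :=
    (integrable_threePoint_iff hl hk hx hx' hu hv hy hf.aestronglyMeasurable).1 hf
  have e : ∫ ω, (l ω * f (x ω, u ω) + k ω * f (x ω, v ω) + f (x' ω, y ω)) ∂ρ =
      ∫ ω, l ω * f (x ω, u ω) ∂ρ + ∫ ω, k ω * f (x ω, v ω) ∂ρ + ∫ ω, f (x' ω, y ω) ∂ρ := by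
    rw [← integral_add i₁ i₂]
    exact integral_add (i₁.add i₂) i₃
  rw [e]
  unfold threePoint at hf ⊢
  have hf' := hf.left_of_add_measure
  rw [integral_add_measure hf' hf.right_of_add_measure,
    integral_add_measure hf'.left_of_add_measure hf'.right_of_add_measure,
    integral_map (hx.prodMk hu).aemeasurable hf'.left_of_add_measure.aestronglyMeasurable,
    integral_map (hx.prodMk hv).aemeasurable hf'.right_of_add_measure.aestronglyMeasurable,
    integral_map (hx'.prodMk hy).aemeasurable hf.right_of_add_measure.aestronglyMeasurable,
    integral_withDensity_eq_integral_smul hl, integral_withDensity_eq_integral_smul hk]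
  rfl

/-- The weights sum to one, so they disappear from the first marginal. The result is symmetric in
`x` and `x'`, hence unchanged by the exchange. -/
lemma map_fst_threePoint (hl : Measurable l) (hx : Measurable x)
    (hx' : Measurable x') (hu : Measurable u) (hv : Measurable v) (hy : Measurable y)
    (hlk : ∀ᵐ ω ∂ρ, l ω + k ω = 1) :
    (threePoint ρ l k x x' u v y).map Prod.fst = ρ.map x + ρ.map x' := by
  have h : (ρ.withDensity fun ω => (l ω : ℝ≥0∞)) + (ρ.withDensity fun ω => (k ω : ℝ≥0∞)) = ρ := by
    rw [← withDensity_add_left hl.coe_nnreal_ennreal]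
    conv_rhs => rw [← withDensity_one (μ := ρ)]
    refine withDensity_congr_ae (hlk.mono fun ω h => ?_)
    simp only [Pi.add_apply, Pi.one_apply]
    exact_mod_cast h
  unfold threePoint
  rw [Measure.map_add _ _ measurable_fst, Measure.map_add _ _ measurable_fst,
    Measure.map_map measurable_fst (hx.prodMk hu), Measure.map_map measurable_fst (hx.prodMk hv),
    Measure.map_map measurable_fst (hx'.prodMk hy)]
  change (ρ.withDensity _).map x + (ρ.withDensity _).map x + ρ.map x' = _
  rw [← Measure.map_add _ _ hx, h]

lemma map_snd_threePoint (hx : Measurable x)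
    (hx' : Measurable x') (hu : Measurable u) (hv : Measurable v) (hy : Measurable y) :
    (threePoint ρ l k x x' u v y).map Prod.snd = (ρ.withDensity fun ω => l ω).map u
      + (ρ.withDensity fun ω => k ω).map v + ρ.map y := by
  unfold threePoint
  rw [Measure.map_add _ _ measurable_snd, Measure.map_add _ _ measurable_snd,
    Measure.map_map measurable_snd (hx.prodMk hu), Measure.map_map measurable_snd (hx.prodMk hv),
    Measure.map_map measurable_snd (hx'.prodMk hy)]
  rfl

end ThreePoint

/-! ### The exchange argument. -/

lemma measure_add_right_cancel {α : Type*} [MeasurableSpace α] {m₁ m₂ m : Measure α}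
    [IsFiniteMeasure m] (h : m₁ + m = m₂ + m) : m₁ = m₂ := by
  rw [← Measure.add_sub_cancel (μ := m₁) (ν := m), h, Measure.add_sub_cancel]

/-- If an optimal coupling dominates a mixture of configurations `(x, u), (x, v), (x', y)` in which
exchanging `x` and `x'` preserves the barycentres and raises the reward, the mixture is trivial. -/
theorem eq_zero_of_reward_lt {Ω : Type*} [MeasurableSpace Ω] {ρ : Measure Ω} [IsFiniteMeasure ρ]
    {l k : Ω → ℝ≥0} {x x' u v y : Ω → ℝ} {μ ν : Measure ℝ} {P : Measure (ℝ × ℝ)}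
    (hμ : Integrable (fun x : ℝ => x) μ) (hν : Integrable (fun y : ℝ => y) ν)
    (hP : IsMartingaleCoupling μ ν P) {c : ℝ → ℝ → ℝ}
    (hcm : Measurable (fun ω : ℝ × ℝ => c ω.1 ω.2))
    (hbound : HasIntegrableUpperBound μ ν c) (hcP : Integrable (fun ω : ℝ × ℝ => c ω.1 ω.2) P)
    (hopt : ∀ P', IsMartingaleCoupling μ ν P' → Integrable (fun ω : ℝ × ℝ => c ω.1 ω.2) P' →
      ∫ ω, c ω.1 ω.2 ∂P' ≤ ∫ ω, c ω.1 ω.2 ∂P)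
    (hl : Measurable l) (hk : Measurable k) (hx : Measurable x)
    (hx' : Measurable x') (hu : Measurable u) (hv : Measurable v) (hy : Measurable y)
    (hlk : ∀ᵐ ω ∂ρ, l ω + k ω = 1) (hbar : ∀ᵐ ω ∂ρ, l ω * u ω + k ω * v ω = y ω)
    (hle : threePoint ρ l k x x' u v y ≤ P)
    (hgain : ∀ᵐ ω ∂ρ, l ω * c (x ω) (u ω) + k ω * c (x ω) (v ω) + c (x' ω) (y ω) <
      l ω * c (x' ω) (u ω) + k ω * c (x' ω) (v ω) + c (x ω) (y ω)) : ρ = 0 := by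
  have := hP.isProbabilityMeasure
  set α := threePoint ρ l k x x' u v y with hα
  set α' := threePoint ρ l k x' x u v y with hα'
  have fα : IsFiniteMeasure α := isFiniteMeasure_of_le P hle
  have e₁ : α.map Prod.fst = α'.map Prod.fst := by
    rw [map_fst_threePoint hl hx hx' hu hv hy hlk, map_fst_threePoint hl hx' hx hu hv hy hlk,
      add_comm]
  have e₂ : α.map Prod.snd = α'.map Prod.snd := by
    rw [map_snd_threePoint hx hx' hu hv hy, map_snd_threePoint hx' hx hu hv hy]
  have eU : α univ = α' univ := by
    have := congrArg (fun m => m univ) e₁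
    simpa [Measure.map_apply measurable_fst] using this
  have fα' : IsFiniteMeasure α' := ⟨by rw [← eU]; exact measure_lt_top _ _⟩
  have iα : ∀ {f : ℝ × ℝ → ℝ}, Integrable f P → Integrable f α := fun h => h.mono_measure hle
  have iα'₁ : ∀ {f : ℝ → ℝ}, Integrable f μ → Integrable (fun p : ℝ × ℝ => f p.1) α' := by
    intro f hf
    refine Integrable.comp_measurable (f := Prod.fst) ?_ measurable_fst
    rw [← e₁]
    refine hf.mono_measure ?_
    rw [← hP.map_fst]
    exact Measure.map_mono hle measurable_fst
  have iα'₂ : ∀ {f : ℝ → ℝ}, Integrable f ν → Integrable (fun p : ℝ × ℝ => f p.2) α' := by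
    intro f hf
    refine Integrable.comp_measurable (f := Prod.snd) ?_ measurable_snd
    rw [← e₂]
    refine hf.mono_measure ?_
    rw [← hP.map_snd]
    exact Measure.map_mono hle measurable_snd
  obtain ⟨a, b, ha, hb, hab⟩ := hbound
  obtain ⟨s₁, s₂, s₃⟩ := (integrable_threePoint_iff hl hk hx hx' hu hv hy
    hcm.aestronglyMeasurable).1 (iα hcP)
  have hH : Integrable (fun p : ℝ × ℝ => a p.1 + b p.2) α' := (iα'₁ ha).add (iα'₂ hb)
  obtain ⟨h₁, h₂, h₃⟩ := (integrable_threePoint_iff hl hk hx' hx hu hv hy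
    hH.aestronglyMeasurable).1 hH
  have ms : ∀ {z w : Ω → ℝ}, Measurable z → Measurable w →
      Measurable fun ω => c (z ω) (w ω) := fun hz hw => hcm.comp (hz.prodMk hw)
  have hlR : Measurable fun ω => (l ω : ℝ) := measurable_coe_nnreal_real.comp hl
  have hkR : Measurable fun ω => (k ω : ℝ) := measurable_coe_nnreal_real.comp hk
  have le₁ : ∀ ω, l ω * c (x' ω) (u ω) ≤ l ω * (a (x' ω) + b (u ω)) := fun ω =>
    mul_le_mul_of_nonneg_left (hab _ _) (l ω).2
  have le₂ : ∀ ω, k ω * c (x' ω) (v ω) ≤ k ω * (a (x' ω) + b (v ω)) := fun ω =>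
    mul_le_mul_of_nonneg_left (hab _ _) (k ω).2
  have le₃ : ∀ ω, c (x ω) (y ω) ≤ a (x ω) + b (y ω) := fun ω => hab _ _
  have D := (s₁.add s₂).add s₃
  -- Each term of the new reward is bounded above through `a ⊕ b`. The gain bounds it below by the
  -- old reward minus the upper bounds of the other two terms.
  have t₁ : Integrable (fun ω => l ω * c (x' ω) (u ω)) ρ := by
    refine integrable_of_le_of_le (hlR.mul (ms hx' hu)).aestronglyMeasurable ?_
      (ae_of_all _ le₁) ((D.sub h₂).sub h₃) h₁
    filter_upwards [hgain] with ω hω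
    have := le₂ ω; have := le₃ ω
    simp only [Pi.sub_apply, Pi.add_apply]
    linarith
  have t₂ : Integrable (fun ω => k ω * c (x' ω) (v ω)) ρ := by
    refine integrable_of_le_of_le (hkR.mul (ms hx' hv)).aestronglyMeasurable ?_
      (ae_of_all _ le₂) ((D.sub h₁).sub h₃) h₂
    filter_upwards [hgain] with ω hω
    have := le₁ ω; have := le₃ ω
    simp only [Pi.sub_apply, Pi.add_apply]
    linarith
  have t₃ : Integrable (fun ω => c (x ω) (y ω)) ρ := by
    refine integrable_of_le_of_le (ms hx hy).aestronglyMeasurable ?_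
      (ae_of_all _ le₃) ((D.sub h₁).sub h₂) h₃
    filter_upwards [hgain] with ω hω
    have := le₁ ω; have := le₂ ω
    simp only [Pi.sub_apply, Pi.add_apply]
    linarith
  have hcα' : Integrable (fun p : ℝ × ℝ => c p.1 p.2) α' :=
    (integrable_threePoint_iff hl hk hx' hx hu hv hy hcm.aestronglyMeasurable).2 ⟨t₁, t₂, t₃⟩
  -- The competitor. Subtraction of measures is truncated, but `α ≤ P` makes it exact, as recorded
  -- additively in `key`.
  set P' := P - α + α' with hP'
  have key : P' + α = P + α' := by
    rw [hP', add_right_comm, Measure.sub_add_cancel_of_le hle]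
  have iP' : ∀ {f : ℝ × ℝ → ℝ}, Integrable f P → Integrable f α' → Integrable f P' :=
    fun h h' => (h.mono_measure Measure.sub_le).add_measure h'
  have integral_key : ∀ {f : ℝ × ℝ → ℝ}, Integrable f P → Integrable f α' →
      ∫ p, f p ∂P' + ∫ p, f p ∂α = ∫ p, f p ∂P + ∫ p, f p ∂α' := by
    intro f h h'
    rw [← integral_add_measure (iP' h h') (iα h), key, integral_add_measure h h']
  have m₁ : P'.map Prod.fst = μ := by
    rw [← hP.map_fst]
    refine measure_add_right_cancel (m := α.map Prod.fst) ?_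
    rw [← Measure.map_add _ _ measurable_fst, key, Measure.map_add _ _ measurable_fst, e₁]
  have m₂ : P'.map Prod.snd = ν := by
    rw [← hP.map_snd]
    refine measure_add_right_cancel (m := α.map Prod.snd) ?_
    rw [← Measure.map_add _ _ measurable_snd, key, Measure.map_add _ _ measurable_snd, e₂]
  have pP' : IsProbabilityMeasure P' := by
    refine ⟨?_⟩
    have h := congrArg (fun m => m univ) (m₁.trans hP.map_fst.symm)
    simpa [Measure.map_apply measurable_fst] using h
  have hcoup : IsMartingaleCoupling μ ν P' := by
    refine isMartingaleCoupling_of_setIntegral hμ hν m₁ m₂ fun B hB => ?_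
    have hB' : MeasurableSet (Prod.fst ⁻¹' B : Set (ℝ × ℝ)) := measurable_fst hB
    have hPB := hP.setIntegral_sub hμ hν hB
    rw [← integral_indicator hB'] at hPB ⊢
    have j : Integrable ((Prod.fst ⁻¹' B).indicator fun p : ℝ × ℝ => p.2 - p.1) P :=
      ((hP.integrable_comp_snd hν).sub (hP.integrable_comp_fst hμ)).indicator hB'
    have j' : Integrable ((Prod.fst ⁻¹' B).indicator fun p : ℝ × ℝ => p.2 - p.1) α' :=
      ((iα'₂ hν).sub (iα'₁ hμ)).indicator hB'
    have h := integral_key j j'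
    rw [hPB, zero_add] at h
    -- Since `l + k = 1` and `l u + k v = y`, both integrands equal `1_B(x) (y - x) + 1_B(x') (y -
    -- x')`.
    suffices hs : ∫ p, (Prod.fst ⁻¹' B).indicator (fun p : ℝ × ℝ => p.2 - p.1) p ∂α =
        ∫ p, (Prod.fst ⁻¹' B).indicator (fun p : ℝ × ℝ => p.2 - p.1) p ∂α' by linarith
    rw [integral_threePoint hl hk hx hx' hu hv hy (iα j),
      integral_threePoint hl hk hx' hx hu hv hy j']
    refine integral_congr_ae ?_
    filter_upwards [hlk, hbar] with ω hω₁ hω₂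
    have hω₁' : (l ω : ℝ) + k ω = 1 := by exact_mod_cast hω₁
    have q : ∀ z w : ℝ, (Prod.fst ⁻¹' B).indicator (fun p : ℝ × ℝ => p.2 - p.1) (z, w) =
        B.indicator 1 z * (w - z) := by
      intro z w
      by_cases hz : z ∈ B <;> simp [indicator, hz]
    simp only [q]
    rw [← hω₂]
    have hk' : (k ω : ℝ) = 1 - l ω := by linarith
    rw [hk']
    ring
  have hfin := hopt P' hcoup (iP' hcP hcα')
  have hkey := integral_key hcP hcα'
  have hle' : ∫ p, c p.1 p.2 ∂α' ≤ ∫ p, c p.1 p.2 ∂α := by linarith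
  have T := (t₁.add t₂).add t₃
  have hz : ∫ ω, ((l ω * c (x' ω) (u ω) + k ω * c (x' ω) (v ω) + c (x ω) (y ω)) -
      (l ω * c (x ω) (u ω) + k ω * c (x ω) (v ω) + c (x' ω) (y ω))) ∂ρ ≤ 0 := by
    rw [integral_threePoint hl hk hx hx' hu hv hy (iα hcP),
      integral_threePoint hl hk hx' hx hu hv hy hcα'] at hle'
    exact (integral_sub T D).trans_le (sub_nonpos.2 hle')
  have hnn : 0 ≤ᵐ[ρ] fun ω => ((l ω * c (x' ω) (u ω) + k ω * c (x' ω) (v ω) + c (x ω) (y ω)) -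
      (l ω * c (x ω) (u ω) + k ω * c (x ω) (v ω) + c (x' ω) (y ω))) :=
    hgain.mono fun ω h => sub_nonneg.2 h.le
  -- Optimality makes the integrated gain nonpositive, while its integrand is strictly positive
  -- almost everywhere; only `ρ = 0` is left.
  have h0 := (integral_eq_zero_iff_of_nonneg_ae hnn (T.sub D)).1
    (le_antisymm hz (integral_nonneg_of_ae hnn))
  have hF : ∀ᵐ ω ∂ρ, False := by
    filter_upwards [h0, hgain] with ω h h'
    simp only [Pi.zero_apply] at h
    linarith
  rwa [Filter.eventually_false_iff_eq_bot, ae_eq_bot] at hF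

/-- Strict convexity of `c_x(ξ, ·)` says that `ξ ↦ l c(ξ, u) + k c(ξ, v) - c(ξ, y)` has positive
derivative; compare its values at `x` and `x'`. -/
lemma MartingaleSpenceMirrlees.reward_lt {c : ℝ → ℝ → ℝ} (hc : MartingaleSpenceMirrlees c)
    {x x' u v y l k : ℝ} (hx : x < x') (huv : u ≠ v) (hl : 0 < l) (hk : 0 < k) (hlk : l + k = 1)
    (hy : l * u + k * v = y) :
    l * c x u + k * c x v + c x' y < l * c x' u + k * c x' v + c x y := by
  have hd : ∀ z ξ, HasDerivAt (fun ξ => c ξ z) (deriv (fun ξ => c ξ z) ξ) ξ := fun z ξ =>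
    ((hc.contDiff z).differentiable one_ne_zero ξ).hasDerivAt
  have hmono : StrictMono fun ξ => l * c ξ u + k * c ξ v - c ξ y := by
    refine strictMono_of_deriv_pos fun ξ => ?_
    rw [((((hd u ξ).const_mul l).fun_add ((hd v ξ).const_mul k)).fun_sub (hd y ξ)).deriv]
    have := (hc.strictConvexOn ξ).2 (mem_univ u) (mem_univ v) huv hl hk hlk
    simp only [smul_eq_mul, hy] at this
    linarith
  have := hmono hx
  simp only at this
  linarith

/-! ### Measures on the line carried by at most two points. -/

lemma exists_rat_of_lt_support {m : Measure ℝ} {a b d : ℝ} (hab : a < b) (hbd : b < d)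
    (ha : a ∈ m.support) (hb : b ∈ m.support) (hd : d ∈ m.support) :
    ∃ q r : ℚ, q < r ∧ m (Iio (q : ℝ)) ≠ 0 ∧ m (Ioo (q : ℝ) r) ≠ 0 ∧ m (Ioi (r : ℝ)) ≠ 0 := by
  obtain ⟨q, hq₁, hq₂⟩ := exists_rat_btwn hab
  obtain ⟨r, hr₁, hr₂⟩ := exists_rat_btwn hbd
  refine ⟨q, r, by exact_mod_cast hq₂.trans hr₁, ?_, ?_, ?_⟩
  · exact ((Measure.mem_support_iff_forall a).1 ha _ (Iio_mem_nhds hq₁)).ne'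
  · exact ((Measure.mem_support_iff_forall b).1 hb _ (Ioo_mem_nhds hq₂ hr₁)).ne'
  · exact ((Measure.mem_support_iff_forall d).1 hd _ (Ioi_mem_nhds hr₂)).ne'

/-- Three points of the support could be separated by two rationals. Rational cuts keep the
hypothesis a countable family, so that it can be verified almost everywhere. -/
lemma exists_pair_of_forall_rat {m : Measure ℝ}
    (h : ∀ q r : ℚ, q < r → ¬(m (Iio (q : ℝ)) ≠ 0 ∧ m (Ioo (q : ℝ) r) ≠ 0 ∧ m (Ioi (r : ℝ)) ≠ 0)) :
    ∃ a b : ℝ, m {a, b}ᶜ = 0 := by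
  have hno : ∀ a b d : ℝ, a ∈ m.support → b ∈ m.support → d ∈ m.support → a < b → b < d → False :=
    fun a b d ha hb hd hab hbd =>
      let ⟨q, r, hqr, h'⟩ := exists_rat_of_lt_support hab hbd ha hb hd
      h q r hqr h'
  have hsub : ∃ a b : ℝ, m.support ⊆ {a, b} := by
    rcases m.support.eq_empty_or_nonempty with h0 | ⟨a, ha⟩
    · exact ⟨0, 0, by simp [h0]⟩
    by_contra! hne
    obtain ⟨b, hb, hba⟩ := not_subset.1 (hne a a)
    obtain ⟨d, hd, hdab⟩ := not_subset.1 (hne a b)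
    simp only [mem_insert_iff, mem_singleton_iff, or_self, not_or] at hba hdab
    rcases lt_or_gt_of_ne hba with h₁ | h₁ <;> rcases lt_or_gt_of_ne hdab.1 with h₂ | h₂ <;>
      rcases lt_or_gt_of_ne hdab.2 with h₃ | h₃
    · exact hno d b a hd hb ha h₃ h₁
    · exact hno b d a hb hd ha h₃ h₂
    · exact hno b a d hb ha hd h₁ h₂
    · exact hno b a d hb ha hd h₁ h₂
    · exact hno d a b hd ha hb h₂ h₁
    · exact hno d a b hd ha hb h₂ h₁
    · exact hno a d b ha hd hb h₂ h₃
    · exact hno a b d ha hb hd h₁ h₃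
  obtain ⟨a, b, hab⟩ := hsub
  exact ⟨a, b, measure_mono_null (compl_subset_compl.2 hab) Measure.measure_compl_support⟩

/-- Without atoms the support of a nonzero measure has at least two points; any `q` strictly between
them works. -/
lemma exists_pos_Iio_Ioi {m : Measure ℝ} (hm : m ≠ 0) (hatom : ∀ x, m {x} = 0) :
    ∃ q : ℝ, m (Iio q) ≠ 0 ∧ m (Ioi q) ≠ 0 := by
  have hs : m.support.Nontrivial := by
    by_contra hs
    rw [not_nontrivial_iff] at hs
    have h0 : m m.support = 0 := by
      rcases hs.eq_empty_or_singleton with h | ⟨x, h⟩ <;> rw [h]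
      · exact measure_empty
      · exact hatom x
    exact hm (Measure.measure_univ_eq_zero.1
      (by rw [← union_compl_self m.support]
          exact measure_union_null h0 Measure.measure_compl_support))
  obtain ⟨a, ha, b, hb, hab⟩ := hs.exists_lt
  obtain ⟨q, hq₁, hq₂⟩ := exists_between hab
  exact ⟨q, ((Measure.mem_support_iff_forall a).1 ha _ (Iio_mem_nhds hq₁)).ne',
    ((Measure.mem_support_iff_forall b).1 hb _ (Ioi_mem_nhds hq₂)).ne'⟩

lemma eq_smul_dirac_add_smul_dirac {m : Measure ℝ} {a b : ℝ} (hab : a ≠ b)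
    (h : m {a, b}ᶜ = 0) : m = m {a} • Measure.dirac a + m {b} • Measure.dirac b := by
  rw [← Measure.restrict_singleton, ← Measure.restrict_singleton,
    ← Measure.restrict_union (by simpa using hab) (measurableSet_singleton b),
    singleton_union]
  exact (Measure.restrict_eq_self_of_ae_mem (mem_ae_iff.2 h)).symm

/-- For `a ≠ b`, total mass and mean form an invertible linear system for the two weights; for `a =
b` both laws are the Dirac mass. -/
lemma eq_of_integral_eq_of_pair {m₁ m₂ : Measure ℝ} [IsProbabilityMeasure m₁]
    [IsProbabilityMeasure m₂] {a b : ℝ} (h₁ : m₁ {a, b}ᶜ = 0) (h₂ : m₂ {a, b}ᶜ = 0)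
    (h : ∫ y, y ∂m₁ = ∫ y, y ∂m₂) : m₁ = m₂ := by
  by_cases hab : a = b
  · subst hab
    have key : ∀ m : Measure ℝ, IsProbabilityMeasure m → m {a, a}ᶜ = 0 → m = Measure.dirac a := by
      intro m _ hm
      rw [pair_eq_singleton] at hm
      have h1 := (prob_compl_eq_zero_iff (measurableSet_singleton a)).1 hm
      have h2 := Measure.restrict_eq_self_of_ae_mem (μ := m) (s := {a}) (mem_ae_iff.2 hm)
      rw [Measure.restrict_singleton, h1, one_smul] at h2
      exact h2.symm
    rw [key m₁ inferInstance h₁, key m₂ inferInstance h₂]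
  · have key : ∀ m : Measure ℝ, IsProbabilityMeasure m → m {a, b}ᶜ = 0 →
        m.real {a} + m.real {b} = 1 ∧ ∫ y, y ∂m = m.real {a} * a + m.real {b} * b := by
      intro m _ hm
      have e := eq_smul_dirac_add_smul_dirac hab hm
      constructor
      · have := (prob_compl_eq_zero_iff ((measurableSet_singleton b).insert a)).1 hm
        rw [← singleton_union, measure_union (by simpa using hab)
          (measurableSet_singleton b)] at this
        rw [measureReal_def, measureReal_def,
          ← ENNReal.toReal_add (measure_ne_top _ _) (measure_ne_top _ _), this, ENNReal.toReal_one]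
      · conv_lhs => rw [e]
        rw [integral_add_measure ((integrable_dirac enorm_lt_top).smul_measure (measure_ne_top _ _))
          ((integrable_dirac enorm_lt_top).smul_measure (measure_ne_top _ _)),
          integral_smul_measure, integral_smul_measure, integral_dirac, integral_dirac]
        rfl
    obtain ⟨s₁, i₁⟩ := key m₁ inferInstance h₁
    obtain ⟨s₂, i₂⟩ := key m₂ inferInstance h₂
    rw [i₁, i₂] at h
    have ha : m₁.real {a} = m₂.real {a} := by
      have : (m₁.real {a} - m₂.real {a}) * (a - b) = 0 := by
        linear_combination h - b * s₁ + b * s₂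
      exact sub_eq_zero.1 ((mul_eq_zero.1 this).resolve_right (sub_ne_zero.2 hab))
    have hb : m₁.real {b} = m₂.real {b} := by linarith
    rw [eq_smul_dirac_add_smul_dirac hab h₁, eq_smul_dirac_add_smul_dirac hab h₂,
      (measureReal_eq_measureReal_iff).1 ha, (measureReal_eq_measureReal_iff).1 hb]

/-! ### Disintegration along the first coordinate. -/

lemma IsMartingaleCoupling.compProd_condKernel {μ ν : Measure ℝ} {P : Measure (ℝ × ℝ)}
    [IsFiniteMeasure P] (hP : IsMartingaleCoupling μ ν P) : μ ⊗ₘ P.condKernel = P := by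
  have := P.disintegrate P.condKernel
  rwa [Measure.fst, hP.map_fst] at this

lemma IsMartingaleCoupling.ae_integral_condKernel {μ ν : Measure ℝ} {P : Measure (ℝ × ℝ)}
    [IsFiniteMeasure P] [IsFiniteMeasure μ]
    (hμ : Integrable (fun x : ℝ => x) μ) (hν : Integrable (fun y : ℝ => y) ν)
    (hP : IsMartingaleCoupling μ ν P) : ∀ᵐ x ∂μ, ∫ y, y ∂(P.condKernel x) = x := by
  have hi : Integrable (fun ω : ℝ × ℝ => ω.2) (μ ⊗ₘ P.condKernel) := by
    rw [hP.compProd_condKernel]; exact hP.integrable_comp_snd hν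
  have hi₁ : Integrable (fun ω : ℝ × ℝ => ω.1) (μ ⊗ₘ P.condKernel) := by
    rw [hP.compProd_condKernel]; exact hP.integrable_comp_fst hμ
  refine Integrable.ae_eq_of_forall_setIntegral_eq _ _ hi.integral_compProd hμ fun B hB _ => ?_
  have h := hP.setIntegral_sub hμ hν hB
  rw [integral_sub (hP.integrable_comp_snd hν).integrableOn
    (hP.integrable_comp_fst hμ).integrableOn, sub_eq_zero] at h
  have h₂ := Measure.setIntegral_compProd hB MeasurableSet.univ hi.integrableOn
  have h₁ := Measure.setIntegral_compProd hB MeasurableSet.univ hi₁.integrableOn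
  rw [hP.compProd_condKernel, prod_univ] at h₁ h₂
  simp only [Measure.restrict_univ] at h₁ h₂
  rw [← h₂, h, h₁]
  simp

/-- The mixture of configurations `((x, (u, v)), (x', y))` with `x ∈ A` and `u ∈ U`, `v ∈ V` drawn
independently from `κ x`, and `(x', y)` drawn from `P` on `T`. -/
noncomputable def configuration (μ : Measure ℝ) (κ : Kernel ℝ ℝ) (P : Measure (ℝ × ℝ)) (A : Set ℝ)
    {U V : Set ℝ} (hU : MeasurableSet U) (hV : MeasurableSet V) (T : Set (ℝ × ℝ)) :
    Measure ((ℝ × (ℝ × ℝ)) × (ℝ × ℝ)) :=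
  ((μ.restrict A) ⊗ₘ (κ.restrict hU ×ₖ κ.restrict hV)).prod (P.restrict T)

/-! ### Projections of the configuration measure are dominated by the coupling. -/

section Configuration

variable {μ : Measure ℝ} [IsProbabilityMeasure μ] {κ : Kernel ℝ ℝ} [IsMarkovKernel κ]
  {P : Measure (ℝ × ℝ)} [IsProbabilityMeasure P] {A U V : Set ℝ} {hU : MeasurableSet U}
  {hV : MeasurableSet V} {T : Set (ℝ × ℝ)}

instance : IsFiniteMeasure (configuration μ κ P A hU hV T) := by
  unfold configuration; infer_instance

omit [IsProbabilityMeasure μ] [IsMarkovKernel κ] in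
lemma configuration_fst_le {S : Set (ℝ × (ℝ × ℝ))} :
    configuration μ κ P A hU hV T (Prod.fst ⁻¹' S) ≤
      ((μ.restrict A) ⊗ₘ (κ.restrict hU ×ₖ κ.restrict hV)) S := by
  rw [configuration, ← prod_univ, Measure.prod_prod]
  exact mul_le_of_le_one_right' ((Measure.restrict_apply_le _ _).trans prob_le_one)

/-- Integrating out `v` and `(x', y)` only contributes factors at most one; what remains is `μ ⊗ₘ κ`
on `A ×ˢ U`. -/
lemma map_left_configuration_le (hP : μ ⊗ₘ κ = P) (hA : MeasurableSet A) :
    (configuration μ κ P A hU hV T).map (fun ω => (ω.1.1, ω.1.2.1)) ≤ P.restrict (A ×ˢ U) := by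
  refine Measure.le_iff.2 fun S hS => ?_
  have hm : Measurable fun p : ℝ × (ℝ × ℝ) => (p.1, p.2.1) := by fun_prop
  rw [Measure.map_apply (by fun_prop) hS]
  refine (configuration_fst_le (S := (fun p : ℝ × (ℝ × ℝ) => (p.1, p.2.1)) ⁻¹' S)).trans ?_
  rw [Measure.compProd_apply (hm hS), Measure.restrict_apply hS, ← hP,
    Measure.compProd_apply (hS.inter (hA.prod hU)), ← lintegral_indicator hA]
  refine lintegral_mono fun x => ?_
  by_cases hx : x ∈ A
  · rw [indicator_of_mem hx, Kernel.prod_apply]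
    have e : Prod.mk x ⁻¹' ((fun p : ℝ × (ℝ × ℝ) => (p.1, p.2.1)) ⁻¹' S) =
        (Prod.mk x ⁻¹' S) ×ˢ univ := by ext; simp
    rw [e, Measure.prod_prod, Kernel.restrict_apply, Kernel.restrict_apply,
      Measure.restrict_apply (measurable_prodMk_left hS)]
    refine (mul_le_of_le_one_right' ((Measure.restrict_apply_le _ _).trans prob_le_one)).trans (measure_mono ?_)
    rintro y ⟨h1, h2⟩
    exact ⟨h1, hx, h2⟩
  · rw [indicator_of_notMem hx]; exact zero_le

lemma map_right_configuration_le (hP : μ ⊗ₘ κ = P) (hA : MeasurableSet A) :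
    (configuration μ κ P A hU hV T).map (fun ω => (ω.1.1, ω.1.2.2)) ≤ P.restrict (A ×ˢ V) := by
  refine Measure.le_iff.2 fun S hS => ?_
  have hm : Measurable fun p : ℝ × (ℝ × ℝ) => (p.1, p.2.2) := by fun_prop
  rw [Measure.map_apply (by fun_prop) hS]
  refine (configuration_fst_le (S := (fun p : ℝ × (ℝ × ℝ) => (p.1, p.2.2)) ⁻¹' S)).trans ?_
  rw [Measure.compProd_apply (hm hS), Measure.restrict_apply hS, ← hP,
    Measure.compProd_apply (hS.inter (hA.prod hV)), ← lintegral_indicator hA]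
  refine lintegral_mono fun x => ?_
  by_cases hx : x ∈ A
  · rw [indicator_of_mem hx, Kernel.prod_apply]
    have e : Prod.mk x ⁻¹' ((fun p : ℝ × (ℝ × ℝ) => (p.1, p.2.2)) ⁻¹' S) =
        univ ×ˢ (Prod.mk x ⁻¹' S) := by ext; simp
    rw [e, Measure.prod_prod, Kernel.restrict_apply, Kernel.restrict_apply _ hV,
      Measure.restrict_apply (measurable_prodMk_left hS)]
    refine (mul_le_of_le_one_left' ((Measure.restrict_apply_le _ _).trans prob_le_one)).trans (measure_mono ?_)
    rintro y ⟨h1, h2⟩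
    exact ⟨h1, hx, h2⟩
  · rw [indicator_of_notMem hx]; exact zero_le

lemma map_snd_configuration_le :
    (configuration μ κ P A hU hV T).map Prod.snd ≤ P.restrict T := by
  refine Measure.le_iff.2 fun S hS => ?_
  rw [Measure.map_apply measurable_snd hS, configuration, ← univ_prod, Measure.prod_prod]
  refine mul_le_of_le_one_left' ?_
  rw [Measure.compProd_apply MeasurableSet.univ]
  calc _ ≤ ∫⁻ _, 1 ∂(μ.restrict A) := lintegral_mono fun x => by
        rw [preimage_univ, Kernel.prod_apply, ← univ_prod_univ, Measure.prod_prod,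
          Kernel.restrict_apply, Kernel.restrict_apply]
        exact mul_le_one' ((Measure.restrict_apply_le _ _).trans prob_le_one)
          ((Measure.restrict_apply_le _ _).trans prob_le_one)
    _ ≤ 1 := by
        rw [lintegral_one]
        exact (Measure.restrict_apply_le _ _).trans prob_le_one

lemma configuration_ne_zero (hA : MeasurableSet A) (hμA : μ A ≠ 0)
    (hκ : ∀ x ∈ A, κ x U ≠ 0 ∧ κ x V ≠ 0) (hT : P T ≠ 0) :
    configuration μ κ P A hU hV T ≠ 0 := by
  intro h
  have h0 := congrArg (fun m => m univ) h
  simp only [configuration, ← univ_prod_univ, Measure.prod_prod, Measure.coe_zero,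
    Pi.zero_apply, mul_eq_zero] at h0
  replace h0 := h0.resolve_right (by rwa [univ_prod_univ, Measure.restrict_apply_univ])
  rw [Measure.compProd_apply_prod MeasurableSet.univ (MeasurableSet.univ.prod MeasurableSet.univ),
    Measure.restrict_univ, lintegral_eq_zero_iff (Kernel.measurable_coe _
      (MeasurableSet.univ.prod MeasurableSet.univ))] at h0
  refine hμA ?_
  have hF : ∀ᵐ x ∂(μ.restrict A), False := by
    filter_upwards [h0, ae_restrict_mem hA] with x hx hxA
    rw [Kernel.prod_apply, Measure.prod_prod] at hx
    simp only [Kernel.restrict_apply, Measure.restrict_apply_univ, Pi.zero_apply,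
      mul_eq_zero] at hx
    exact hx.elim (hκ x hxA).1 (hκ x hxA).2
  rwa [Filter.eventually_false_iff_eq_bot, ae_eq_bot, Measure.restrict_eq_zero] at hF

end Configuration

/-! ### Conditional laws of an optimal coupling. -/

lemma ae_of_map_le_restrict {Ω : Type*} [MeasurableSpace Ω] {ρ : Measure Ω}
    {P : Measure (ℝ × ℝ)} {f : Ω → ℝ × ℝ} {S : Set (ℝ × ℝ)} (hf : Measurable f)
    (hS : MeasurableSet S) (h : ρ.map f ≤ P.restrict S) : ∀ᵐ ω ∂ρ, f ω ∈ S :=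
  ae_of_ae_map hf.aemeasurable (ae_mono h (ae_restrict_mem hS))

lemma withDensity_coe_le {Ω : Type*} [MeasurableSpace Ω] {ρ : Measure Ω} {l : Ω → ℝ≥0}
    (h : ∀ᵐ ω ∂ρ, l ω ≤ 1) : (ρ.withDensity fun ω => (l ω : ℝ≥0∞)) ≤ ρ := by
  conv_rhs => rw [← withDensity_one (μ := ρ)]
  exact withDensity_mono (h.mono fun ω hω => by simpa using hω)

/-- For an optimal coupling and `q < r`, almost no conditional law charges all of `(-∞, q)`,
`(q, r)` and `(r, ∞)`. -/
lemma ae_not_charges_three {μ ν : Measure ℝ} [IsProbabilityMeasure μ] {P : Measure (ℝ × ℝ)}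
    [IsProbabilityMeasure P]
    (hμ : Integrable (fun x : ℝ => x) μ) (hν : Integrable (fun y : ℝ => y) ν)
    (hatom : ∀ x : ℝ, μ {x} = 0)
    (hP : IsMartingaleCoupling μ ν P) {c : ℝ → ℝ → ℝ} (hc : MartingaleSpenceMirrlees c)
    (hbound : HasIntegrableUpperBound μ ν c) (hcP : Integrable (fun ω : ℝ × ℝ => c ω.1 ω.2) P)
    (hopt : ∀ P', IsMartingaleCoupling μ ν P' → Integrable (fun ω : ℝ × ℝ => c ω.1 ω.2) P' →
      ∫ ω, c ω.1 ω.2 ∂P' ≤ ∫ ω, c ω.1 ω.2 ∂P) {q r : ℝ} (hqr : q < r) :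
    ∀ᵐ x ∂μ, ¬(P.condKernel x (Iio q) ≠ 0 ∧ P.condKernel x (Ioo q r) ≠ 0 ∧
      P.condKernel x (Ioi r) ≠ 0) := by
  set κ := P.condKernel with hκ
  have hdis : μ ⊗ₘ κ = P := hP.compProd_condKernel
  set A : Set ℝ := {x | κ x (Iio q) ≠ 0 ∧ κ x (Ioo q r) ≠ 0 ∧ κ x (Ioi r) ≠ 0} with hA
  have hAm : MeasurableSet A := by
    have h : ∀ S : Set ℝ, MeasurableSet S → MeasurableSet {x | κ x S ≠ 0} := fun S hS =>
      (κ.measurable_coe hS (measurableSet_singleton 0)).compl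
    exact (h _ measurableSet_Iio).inter ((h _ measurableSet_Ioo).inter (h _ measurableSet_Ioi))
  suffices h0 : μ A = 0 from measure_eq_zero_iff_ae_notMem.1 h0
  by_contra hμA
  -- Absence of atoms is used here: `z` splits `A` into two parts of positive mass, supplying `x < z
  -- < x'`.
  obtain ⟨z, hz₁, hz₂⟩ := exists_pos_Iio_Ioi (m := μ.restrict A)
    (by rwa [Ne, Measure.restrict_eq_zero])
    fun x => le_antisymm ((Measure.restrict_apply_le _ _).trans (hatom x).le) zero_le
  rw [Measure.restrict_apply measurableSet_Iio] at hz₁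
  rw [Measure.restrict_apply measurableSet_Ioi] at hz₂
  have hA₁ : MeasurableSet (Iio z ∩ A) := measurableSet_Iio.inter hAm
  have hA₂ : MeasurableSet (Ioi z ∩ A) := measurableSet_Ioi.inter hAm
  have hT : P ((Ioi z ∩ A) ×ˢ Ioo q r) ≠ 0 := by
    intro h
    rw [← hdis, Measure.compProd_apply_prod hA₂ measurableSet_Ioo,
      lintegral_eq_zero_iff (κ.measurable_coe measurableSet_Ioo)] at h
    have hF : ∀ᵐ x ∂(μ.restrict (Ioi z ∩ A)), False := by
      filter_upwards [h, ae_restrict_mem hA₂] with x hx hxA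
      exact hxA.2.2.1 hx
    rw [Filter.eventually_false_iff_eq_bot, ae_eq_bot, Measure.restrict_eq_zero] at hF
    exact hz₂ hF
  set ρ := configuration μ κ P (Iio z ∩ A) (U := Iio q) (V := Ioi r) measurableSet_Iio
    measurableSet_Ioi ((Ioi z ∩ A) ×ˢ Ioo q r) with hρ
  have hS₁ : MeasurableSet ((Iio z ∩ A) ×ˢ Iio q) := hA₁.prod measurableSet_Iio
  have hS₂ : MeasurableSet ((Iio z ∩ A) ×ˢ Ioi r) := hA₁.prod measurableSet_Ioi
  have hS₃ : MeasurableSet ((Ioi z ∩ A) ×ˢ Ioo q r) := hA₂.prod measurableSet_Ioo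
  have l₁ : ρ.map (fun ω => (ω.1.1, ω.1.2.1)) ≤ P.restrict ((Iio z ∩ A) ×ˢ Iio q) :=
    map_left_configuration_le hdis hA₁
  have l₂ : ρ.map (fun ω => (ω.1.1, ω.1.2.2)) ≤ P.restrict ((Iio z ∩ A) ×ˢ Ioi r) :=
    map_right_configuration_le hdis hA₁
  have l₃ : ρ.map Prod.snd ≤ P.restrict ((Ioi z ∩ A) ×ˢ Ioo q r) := map_snd_configuration_le
  have a₁ := ae_of_map_le_restrict (by fun_prop) hS₁ l₁
  have a₂ := ae_of_map_le_restrict (by fun_prop) hS₂ l₂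
  have a₃ := ae_of_map_le_restrict (by fun_prop) hS₃ l₃
  -- Barycentric weights of `y` between `u` and `v`. Both quotients are positive `ρ`-almost
  -- everywhere, so `Real.toNNReal` truncates nothing there.
  set l : (ℝ × (ℝ × ℝ)) × (ℝ × ℝ) → ℝ≥0 := fun ω =>
    Real.toNNReal ((ω.1.2.2 - ω.2.2) / (ω.1.2.2 - ω.1.2.1)) with hl
  set k : (ℝ × (ℝ × ℝ)) × (ℝ × ℝ) → ℝ≥0 := fun ω =>
    Real.toNNReal ((ω.2.2 - ω.1.2.1) / (ω.1.2.2 - ω.1.2.1)) with hk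
  have hlm : Measurable l := by fun_prop
  have hkm : Measurable k := by fun_prop
  have hw : ∀ᵐ ω ∂ρ, ω.1.1 < ω.2.1 ∧ ω.1.2.1 ≠ ω.1.2.2 ∧ 0 < (l ω : ℝ) ∧ 0 < (k ω : ℝ) ∧
      (l ω : ℝ) + k ω = 1 ∧ l ω * ω.1.2.1 + k ω * ω.1.2.2 = ω.2.2 := by
    filter_upwards [a₁, a₂, a₃] with ω h₁ h₂ h₃
    obtain ⟨⟨hx, -⟩, hu⟩ := h₁
    obtain ⟨-, hv⟩ := h₂
    obtain ⟨⟨hx', -⟩, hy₁, hy₂⟩ := h₃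
    simp only [mem_Iio, mem_Ioi] at hx hu hv hx' hy₁ hy₂
    have p₁ : 0 < ω.1.2.2 - ω.2.2 := by linarith
    have p₂ : 0 < ω.2.2 - ω.1.2.1 := by linarith
    have p₃ : 0 < ω.1.2.2 - ω.1.2.1 := by linarith
    have el : (l ω : ℝ) = (ω.1.2.2 - ω.2.2) / (ω.1.2.2 - ω.1.2.1) :=
      Real.coe_toNNReal _ (div_pos p₁ p₃).le
    have ek : (k ω : ℝ) = (ω.2.2 - ω.1.2.1) / (ω.1.2.2 - ω.1.2.1) :=
      Real.coe_toNNReal _ (div_pos p₂ p₃).le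
    rw [el, ek]
    refine ⟨by linarith, by linarith, div_pos p₁ p₃, div_pos p₂ p₃, ?_, ?_⟩
    · field_simp; ring
    · field_simp; ring
  have hlk : ∀ᵐ ω ∂ρ, l ω + k ω = 1 := hw.mono fun ω h => by exact_mod_cast h.2.2.2.2.1
  refine configuration_ne_zero hA₁ hz₁ (fun x hx => ⟨hx.2.1, hx.2.2.2⟩) hT
    (eq_zero_of_reward_lt (ρ := ρ) (x := fun ω => ω.1.1) (x' := fun ω => ω.2.1)
      (u := fun ω => ω.1.2.1) (v := fun ω => ω.1.2.2) (y := fun ω => ω.2.2) hμ hν hP hc.measurable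
      hbound hcP hopt hlm hkm (by fun_prop) (by fun_prop) (by fun_prop) (by fun_prop) (by fun_prop)
      hlk (hw.mono fun ω h => h.2.2.2.2.2) ?_ (hw.mono fun ω h =>
        hc.reward_lt h.1 h.2.1 h.2.2.1 h.2.2.2.1 h.2.2.2.2.1 h.2.2.2.2.2))
  have b₁ : (ρ.withDensity fun ω => (l ω : ℝ≥0∞)).map (fun ω => (ω.1.1, ω.1.2.1)) ≤
      P.restrict ((Iio z ∩ A) ×ˢ Iio q) :=
    (Measure.map_mono (withDensity_coe_le (hlk.mono fun ω h => h ▸ le_self_add))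
      (by fun_prop)).trans l₁
  have b₂ : (ρ.withDensity fun ω => (k ω : ℝ≥0∞)).map (fun ω => (ω.1.1, ω.1.2.2)) ≤
      P.restrict ((Iio z ∩ A) ×ˢ Ioi r) :=
    (Measure.map_mono (withDensity_coe_le (hlk.mono fun ω h => h ▸ le_add_self))
      (by fun_prop)).trans l₂
  -- The three images live on disjoint rectangles, so their separate bounds by `P` add up to a bound
  -- by `P` itself, with no rescaling of `ρ`.
  have d₁ : Disjoint ((Iio z ∩ A) ×ˢ Iio q) ((Iio z ∩ A) ×ˢ Ioi r) :=
    disjoint_left.2 fun p h h' => by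
      have h₁ : p.2 < q := h.2
      have h₂ : r < p.2 := h'.2
      linarith
  have d₂ : Disjoint ((Iio z ∩ A) ×ˢ Iio q ∪ (Iio z ∩ A) ×ˢ Ioi r) ((Ioi z ∩ A) ×ˢ Ioo q r) :=
    disjoint_left.2 fun p h h' => by
      have h₁ : p.1 < z := h.elim (fun h => h.1.1) fun h => h.1.1
      have h₂ : z < p.1 := h'.1.1
      linarith
  calc _ ≤ P.restrict ((Iio z ∩ A) ×ˢ Iio q) + P.restrict ((Iio z ∩ A) ×ˢ Ioi r)
        + P.restrict ((Ioi z ∩ A) ×ˢ Ioo q r) := add_le_add (add_le_add b₁ b₂) l₃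
    _ = P.restrict ((Iio z ∩ A) ×ˢ Iio q ∪ (Iio z ∩ A) ×ˢ Ioi r ∪ (Ioi z ∩ A) ×ˢ Ioo q r) := by
        rw [Measure.restrict_union d₂ hS₃, Measure.restrict_union d₁ hS₂]
    _ ≤ P := Measure.restrict_le_self

/-- The conditional laws of an optimal coupling are almost surely carried by at most two points. -/
lemma ae_exists_pair {μ ν : Measure ℝ} [IsProbabilityMeasure μ] {P : Measure (ℝ × ℝ)}
    [IsProbabilityMeasure P]
    (hμ : Integrable (fun x : ℝ => x) μ) (hν : Integrable (fun y : ℝ => y) ν)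
    (hatom : ∀ x : ℝ, μ {x} = 0)
    (hP : IsMartingaleCoupling μ ν P) {c : ℝ → ℝ → ℝ} (hc : MartingaleSpenceMirrlees c)
    (hbound : HasIntegrableUpperBound μ ν c) (hcP : Integrable (fun ω : ℝ × ℝ => c ω.1 ω.2) P)
    (hopt : ∀ P', IsMartingaleCoupling μ ν P' → Integrable (fun ω : ℝ × ℝ => c ω.1 ω.2) P' →
      ∫ ω, c ω.1 ω.2 ∂P' ≤ ∫ ω, c ω.1 ω.2 ∂P) :
    ∀ᵐ x ∂μ, ∃ a b : ℝ, P.condKernel x {a, b}ᶜ = 0 := by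
  have h : ∀ᵐ x ∂μ, ∀ q r : ℚ, q < r → ¬(P.condKernel x (Iio (q : ℝ)) ≠ 0 ∧
      P.condKernel x (Ioo (q : ℝ) r) ≠ 0 ∧ P.condKernel x (Ioi (r : ℝ)) ≠ 0) := by
    simp only [ae_all_iff]
    exact fun q r hqr => ae_not_charges_three hμ hν hatom hP hc hbound hcP hopt
      (Rat.cast_lt.2 hqr)
  exact h.mono fun x hx => exists_pair_of_forall_rat hx

/-! ### Midpoints, optimality and uniqueness. -/

lemma IsMartingaleCoupling.midpoint {μ ν : Measure ℝ} {P₁ P₂ : Measure (ℝ × ℝ)}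
    (hμ : Integrable (fun x : ℝ => x) μ) (hν : Integrable (fun y : ℝ => y) ν)
    (h₁ : IsMartingaleCoupling μ ν P₁) (h₂ : IsMartingaleCoupling μ ν P₂) :
    IsMartingaleCoupling μ ν ((2⁻¹ : ℝ≥0∞) • (P₁ + P₂)) := by
  have := h₁.isProbabilityMeasure
  have := h₂.isProbabilityMeasure
  have half : ∀ m : Measure ℝ, (2⁻¹ : ℝ≥0∞) • (m + m) = m := fun m => by
    rw [← two_smul ℝ≥0∞ m, smul_smul, ENNReal.inv_mul_cancel two_ne_zero ENNReal.ofNat_ne_top,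
      one_smul]
  have hp : IsProbabilityMeasure ((2⁻¹ : ℝ≥0∞) • (P₁ + P₂)) := ⟨by
    rw [Measure.smul_apply, Measure.add_apply, measure_univ, measure_univ, smul_eq_mul,
      one_add_one_eq_two, ENNReal.inv_mul_cancel two_ne_zero ENNReal.ofNat_ne_top]⟩
  refine isMartingaleCoupling_of_setIntegral hμ hν ?_ ?_ fun B hB => ?_
  · rw [Measure.map_smul, Measure.map_add _ _ measurable_fst, h₁.map_fst, h₂.map_fst, half]
  · rw [Measure.map_smul, Measure.map_add _ _ measurable_snd, h₁.map_snd, h₂.map_snd, half]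
  · have i : ∀ {P : Measure (ℝ × ℝ)}, IsMartingaleCoupling μ ν P →
        IntegrableOn (fun ω : ℝ × ℝ => ω.2 - ω.1) (Prod.fst ⁻¹' B) P := fun h =>
      ((h.integrable_comp_snd hν).sub (h.integrable_comp_fst hμ)).integrableOn
    rw [Measure.restrict_smul, integral_smul_measure, Measure.restrict_add,
      integral_add_measure (i h₁) (i h₂), h₁.setIntegral_sub hμ hν hB, h₂.setIntegral_sub hμ hν hB, add_zero, smul_zero]

lemma IsSolution.integrable {μ ν : Measure ℝ} {c : ℝ → ℝ → ℝ} {P : Measure (ℝ × ℝ)}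
    (hcm : Measurable (fun ω : ℝ × ℝ => c ω.1 ω.2)) (hbound : HasIntegrableUpperBound μ ν c)
    (hfinite : transportValue μ ν c ≠ ⊥) (hP : IsSolution μ ν c P) :
    Integrable (fun ω : ℝ × ℝ => c ω.1 ω.2) P := by
  obtain ⟨a, b, ha, hb, hab⟩ := hbound
  exact integrable_of_extExpectation_ne_bot hcm
    ((hP.1.integrable_comp_fst ha).add (hP.1.integrable_comp_snd hb)) (fun ω => hab ω.1 ω.2)
    (hP.2 ▸ hfinite)

lemma IsSolution.integral_le {μ ν : Measure ℝ} {c : ℝ → ℝ → ℝ} {P P' : Measure (ℝ × ℝ)}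
    (hP : IsSolution μ ν c P) (hcP : Integrable (fun ω : ℝ × ℝ => c ω.1 ω.2) P)
    (hP' : IsMartingaleCoupling μ ν P') (hcP' : Integrable (fun ω : ℝ × ℝ => c ω.1 ω.2) P') :
    ∫ ω, c ω.1 ω.2 ∂P' ≤ ∫ ω, c ω.1 ω.2 ∂P := by
  have h : extExpectation P' (fun ω => c ω.1 ω.2) ≤ extExpectation P (fun ω => c ω.1 ω.2) := by
    rw [hP.2]
    exact le_iSup₂ (f := fun (Q : Measure (ℝ × ℝ)) (_ : IsMartingaleCoupling μ ν Q) =>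
      extExpectation Q (fun ω => c ω.1 ω.2)) P' hP'
  rwa [extExpectation_of_integrable hcP, extExpectation_of_integrable hcP',
    EReal.coe_le_coe_iff] at h

/-- The common first marginal `μ` lets absolute continuity pass to the fibres. Thus a pair carrying
a conditional law of `Q` also carries that of `P`. -/
lemma ae_condKernel_absolutelyContinuous {μ ν : Measure ℝ} [IsProbabilityMeasure μ]
    {P Q : Measure (ℝ × ℝ)} [IsFiniteMeasure P] [IsFiniteMeasure Q]
    (hP : IsMartingaleCoupling μ ν P) (hQ : IsMartingaleCoupling μ ν Q) (h : P ≪ Q) :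
    ∀ᵐ x ∂μ, P.condKernel x ≪ Q.condKernel x := by
  refine Measure.AbsolutelyContinuous.kernel_of_compProd (μ := μ) (ν := μ) ?_
  rwa [hP.compProd_condKernel, hQ.compProd_condKernel]

end MOT

theorem mainTheorem3 (μ ν : Measure ℝ) [IsProbabilityMeasure μ] [IsProbabilityMeasure ν]
    (hμ : Integrable (fun x : ℝ => x) μ) (hν : Integrable (fun y : ℝ => y) ν)
    (hμν : MOT.ConvexOrder μ ν) (hatom : ∀ x : ℝ, μ {x} = 0)
    (c : ℝ → ℝ → ℝ) (hc : MOT.MartingaleSpenceMirrlees c)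
    (hbound : MOT.HasIntegrableUpperBound μ ν c)
    (hfinite : MOT.transportValue μ ν c ≠ ⊥) :
    ∀ P₁ P₂ : Measure (ℝ × ℝ), MOT.IsSolution μ ν c P₁ → MOT.IsSolution μ ν c P₂ → P₁ = P₂ := by
  intro P₁ P₂ h₁ h₂
  have := h₁.1.isProbabilityMeasure
  have := h₂.1.isProbabilityMeasure
  have i₁ := h₁.integrable hc.measurable hbound hfinite
  have i₂ := h₂.integrable hc.measurable hbound hfinite
  have hQ := h₁.1.midpoint hμ hν h₂.1
  set Q := (2⁻¹ : ENNReal) • (P₁ + P₂) with hQdef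
  have := hQ.isProbabilityMeasure
  have iQ : Integrable (fun ω : ℝ × ℝ => c ω.1 ω.2) Q :=
    (i₁.add_measure i₂).smul_measure (by simp)
  -- The two solutions have equal rewards, so the midpoint is optimal too and the two-point property
  -- applies to it.
  have eQ : ∫ ω, c ω.1 ω.2 ∂Q = ∫ ω, c ω.1 ω.2 ∂P₁ := by
    rw [hQdef, integral_smul_measure, integral_add_measure i₁ i₂,
      le_antisymm (h₁.integral_le i₁ h₂.1 i₂) (h₂.integral_le i₂ h₁.1 i₁)]
    simp only [ENNReal.toReal_inv, ENNReal.toReal_ofNat, smul_eq_mul]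
    ring
  have ac : P₁ + P₂ ≪ Q := Measure.absolutelyContinuous_smul (by simp)
  have ac₁ := MOT.ae_condKernel_absolutelyContinuous h₁.1 hQ
    (((Measure.le_add_right le_rfl).absolutelyContinuous).trans ac)
  have ac₂ := MOT.ae_condKernel_absolutelyContinuous h₂.1 hQ
    (((Measure.le_add_left le_rfl).absolutelyContinuous).trans ac)
  rw [← h₁.1.compProd_condKernel, ← h₂.1.compProd_condKernel]
  refine Measure.compProd_congr ?_
  filter_upwards [ac₁, ac₂, h₁.1.ae_integral_condKernel hμ hν, h₂.1.ae_integral_condKernel hμ hν,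
    MOT.ae_exists_pair hμ hν hatom hQ hc hbound iQ
      fun P' hP' iP' => (h₁.integral_le i₁ hP' iP').trans eQ.ge] with x k₁ k₂ m₁ m₂ ⟨a, b, hab⟩
  exact MOT.eq_of_integral_eq_of_pair (k₁ hab) (k₂ hab) (m₁.trans m₂.symm)
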